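/- Let $N$ be a positive integer, let $\Sigma_N$ be the symmetric group on $\{1,\dots,N\}$, and let $X$ be the set of all $\tau\in\Sigma_N$ with $\tau^2=1$ (the identity included). For $\sigma\in\Sigma_N$ and $\tau=(p_1\,p_2)(p_3\,p_4)\cdots(p_{2j-1}\,p_{2j})\in X$, a product of disjoint transpositions written with $p_{2k-1}<p_{2k}$ for all $k$, put $$S(\sigma,\tau)=(-1)^{\#\{k\,:\,\sigma(p_{2k-1})>\sigma(p_{2k})\}}.$$ Let $A$ be the complex vector space with basis $X$, with the representation of $\Sigma_N$ given on basis vectors by $\sigma\cdot\tau=S(\sigma,\tau)\,\sigma\tau\sigma^{-1}$. For $0\le j\le\lfloor N/2\rfloor$ let $V_j\subseteq A$ be the subrepresentation spanned by the $\tau\in X$ that are products of exactly $j$ disjoint transpositions. Then $A=\bigoplus_{j=0}^{\lfloor N/2\rfloor}V_j$, and $A$ contains every irreducible complex representation of $\Sigma_N$ exactly once: $A$ is a direct sum of irreducible subrepresentations, among which every irreducible complex representation of $\Sigma_N$ occurs, up to isomorphism, exactly once. In other words, $A$ is a Gelfand model for $\Sigma_N$. -/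

import Mathlib

/-- The involutions of the symmetric group on `Fin N`: the permutations with square the identity
(the identity itself included). -/
abbrev Involutions (N : ℕ) : Type := {τ : Equiv.Perm (Fin N) // τ * τ = 1}

namespace Involutions

/-- `τ` has length `j`: it is a product of exactly `j` disjoint transpositions. -/
def HasLength {N : ℕ} (τ : Involutions N) (j : ℕ) : Prop :=
  τ.1.cycleType = Multiset.replicate j 2

/-- The conjugate `σ τ σ⁻¹` of an involution. -/
def conj {N : ℕ} (σ : Equiv.Perm (Fin N)) (τ : Involutions N) : Involutions N :=
  ⟨σ * τ.1 * σ⁻¹, by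
    have h := τ.2
    calc σ * τ.1 * σ⁻¹ * (σ * τ.1 * σ⁻¹) = σ * (τ.1 * τ.1) * σ⁻¹ := by group
      _ = 1 := by rw [h]; group⟩

/-- The sign `S(σ, τ)`: the parity of the number of transpositions `(p q)` of `τ`, written with
`p < q = τ p`, such that `σ p > σ q`. -/
noncomputable def S {N : ℕ} (σ : Equiv.Perm (Fin N)) (τ : Involutions N) : ℂ :=
  (-1) ^ (Finset.univ.filter fun p : Fin N => p < τ.1 p ∧ σ p > σ (τ.1 p)).card

lemma conj_one {N : ℕ} (τ : Involutions N) : conj 1 τ = τ := by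
  apply Subtype.ext; simp [conj]

lemma conj_mul {N : ℕ} (σ' σ : Equiv.Perm (Fin N)) (τ : Involutions N) :
    conj (σ' * σ) τ = conj σ' (conj σ τ) := by
  apply Subtype.ext; simp [conj, mul_assoc]

lemma apply_apply {N : ℕ} (τ : Involutions N) (p : Fin N) : τ.1 (τ.1 p) = p := by
  have h := congrArg (fun f : Equiv.Perm (Fin N) => f p) τ.2
  simpa using h

lemma S_eq_prod {N : ℕ} (σ : Equiv.Perm (Fin N)) (τ : Involutions N) :
    S σ τ = ∏ p ∈ Finset.univ.filter (fun p : Fin N => p < τ.1 p),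
      (if σ p > σ (τ.1 p) then (-1 : ℂ) else 1) := by
  rw [Finset.prod_ite, Finset.prod_const, Finset.prod_const_one, mul_one, Finset.filter_filter, S]

lemma S_one {N : ℕ} (τ : Involutions N) : S 1 τ = 1 := by
  rw [S_eq_prod]
  refine Finset.prod_eq_one fun p hp => ?_
  have hp' : p < τ.1 p := by simpa using hp
  simp [hp'.le]

lemma S_mul {N : ℕ} (σ' σ : Equiv.Perm (Fin N)) (τ : Involutions N) :
    S (σ' * σ) τ = S σ' (conj σ τ) * S σ τ := by
  have hne : ∀ (ρ : Equiv.Perm (Fin N)) {p q : Fin N}, p ≠ q → ρ p ≠ ρ q :=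
    fun ρ p q h h' => h (ρ.injective h')
  have hc : ∀ q, (conj σ τ).1 q = σ (τ.1 (σ⁻¹ q)) := fun q => rfl
  have key : S σ' (conj σ τ) = ∏ p ∈ Finset.univ.filter (fun p : Fin N => p < τ.1 p),
      ((if σ' (σ p) > σ' (σ (τ.1 p)) then (-1 : ℂ) else 1) *
        (if σ p > σ (τ.1 p) then (-1 : ℂ) else 1)) := by
    rw [S_eq_prod]
    symm
    refine Finset.prod_bij' (fun p _ => if σ p < σ (τ.1 p) then σ p else σ (τ.1 p))
      (fun q _ => if σ⁻¹ q < τ.1 (σ⁻¹ q) then σ⁻¹ q else τ.1 (σ⁻¹ q)) ?_ ?_ ?_ ?_ ?_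
    · intro p hp
      have hp' : p < τ.1 p := by simpa using hp
      have := hne σ hp'.ne
      by_cases h : σ p < σ (τ.1 p)
      · simp [hc, h]
      · have h2 : σ (τ.1 p) < σ p := lt_of_le_of_ne (not_lt.mp h) this.symm
        simp [hc, h, h2, apply_apply]
    · intro q hq
      have hq' : q < σ (τ.1 (σ⁻¹ q)) := by simpa [hc] using hq
      have h1 : σ⁻¹ q ≠ τ.1 (σ⁻¹ q) := by
        intro h
        rw [← h] at hq'
        simp at hq'
      by_cases h : σ⁻¹ q < τ.1 (σ⁻¹ q)
      · simp only [h, if_true, Finset.mem_filter, Finset.mem_univ, true_and]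
      · have h2 : τ.1 (σ⁻¹ q) < σ⁻¹ q := lt_of_le_of_ne (not_lt.mp h) h1.symm
        simp only [h, if_false, Finset.mem_filter, Finset.mem_univ, true_and, apply_apply, h2]
    · intro p hp
      have hp' : p < τ.1 p := by simpa using hp
      by_cases h : σ p < σ (τ.1 p)
      · simp [h, hp']
      · simp [h, apply_apply, hp'.le]
    · intro q hq
      have hq' : q < σ (τ.1 (σ⁻¹ q)) := by simpa [hc] using hq
      have e : σ (σ⁻¹ q) = q := by simp
      by_cases h : σ⁻¹ q < τ.1 (σ⁻¹ q)
      · simp only [h, if_true, e, hq']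
      · simp only [h, if_false, apply_apply, e, not_lt.mpr hq'.le]
    · intro p hp
      have hp' : p < τ.1 p := by simpa using hp
      have h1 := hne σ hp'.ne
      have h3 := hne σ' h1
      have e : ∀ x, σ⁻¹ (σ x) = x := fun x => by simp
      by_cases h : σ p < σ (τ.1 p)
      · simp only [h, if_true, hc, e, gt_iff_lt, not_lt.mpr h.le, if_false, mul_one]
      · have h2 : σ (τ.1 p) < σ p := lt_of_le_of_ne (not_lt.mp h) h1.symm
        simp only [h, if_false, hc, e, gt_iff_lt, h2, if_true, apply_apply]
        by_cases h4 : σ' (σ (τ.1 p)) < σ' (σ p)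
        · simp [h4, not_lt.mpr h4.le]
        · have h5 : σ' (σ p) < σ' (σ (τ.1 p)) := lt_of_le_of_ne (not_lt.mp h4) h3
          simp [h5, not_lt.mpr h5.le]
  rw [key, S_eq_prod, S_eq_prod, ← Finset.prod_mul_distrib]
  refine Finset.prod_congr rfl fun p _ => ?_
  simp only [Equiv.Perm.mul_apply]
  by_cases h1 : σ' (σ p) > σ' (σ (τ.1 p)) <;> by_cases h2 : σ p > σ (τ.1 p) <;>
    simp only [h1, h2, if_true, if_false] <;> norm_num

end Involutions

/-- The signed conjugation representation of the symmetric group on the complex vector space with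
basis its involutions: `σ · τ = S(σ, τ) (σ τ σ⁻¹)` on basis vectors. -/
noncomputable def signedConjRep (N : ℕ) :
    Representation ℂ (Equiv.Perm (Fin N)) (Involutions N →₀ ℂ) where
  toFun σ := Finsupp.linearCombination ℂ fun τ : Involutions N =>
    Involutions.S σ τ • Finsupp.single (Involutions.conj σ τ) (1 : ℂ)
  map_one' := by
    ext τ : 2
    simp [Involutions.S_one, Involutions.conj_one]
  map_mul' σ' σ := by
    ext τ : 2
    simp [Involutions.S_mul, Involutions.conj_mul, mul_comm]

/-- The subrepresentation `V_j`, spanned by the involutions that are products of `j` disjoint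
transpositions. -/
noncomputable def lengthSubrep (N j : ℕ) : Subrepresentation (signedConjRep N) where
  toSubmodule := Submodule.span ℂ
    ((fun τ : Involutions N => Finsupp.single τ (1 : ℂ)) '' {τ | τ.HasLength j})
  apply_mem_toSubmodule σ v hv := by
    induction hv using Submodule.span_induction with
    | mem x hx =>
      obtain ⟨τ, hτ, rfl⟩ := hx
      have h : signedConjRep N σ (Finsupp.single τ (1 : ℂ)) =
          Involutions.S σ τ • Finsupp.single (Involutions.conj σ τ) (1 : ℂ) := by
        simp [signedConjRep]
      change signedConjRep N σ (Finsupp.single τ (1 : ℂ)) ∈ _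
      rw [h]
      refine Submodule.smul_mem _ _ (Submodule.subset_span ⟨_, ?_, rfl⟩)
      have hτ' : τ.1.cycleType = Multiset.replicate j 2 := hτ
      change (σ * τ.1 * σ⁻¹).cycleType = _
      rw [Equiv.Perm.cycleType_conj, hτ']
    | zero => simp
    | add x y _ _ hx hy => rw [map_add]; exact Submodule.add_mem _ hx hy
    | smul c x _ hx => rw [map_smul]; exact Submodule.smul_mem _ _ hx

universe u v w

/-- `ρ` is a Gelfand model: it is a finite direct sum of irreducible subrepresentations among which every
irreducible complex representation of `G` occurs, up to isomorphism, exactly once. -/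
def IsGelfandModel {G : Type u} [Group G] {V : Type v} [AddCommGroup V] [Module ℂ V]
    (ρ : Representation ℂ G V) : Prop :=
  ∃ (n : ℕ) (U : Fin n → Subrepresentation ρ),
    DirectSum.IsInternal (fun i => (U i).toSubmodule) ∧
    (∀ i, (U i).toRepresentation.IsIrreducible) ∧
    ∀ (W : Type w) [AddCommGroup W] [Module ℂ W] (θ : Representation ℂ G W),
      θ.IsIrreducible → ∃! i, Nonempty ((U i).toRepresentation.Equiv θ)

/-! By Maschke's theorem and orthogonality of characters, it suffices that every irreducible
character θ has scalar product 1 with the character of A. A basis vector τ contributes to the trace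
of σ only if it commutes with σ, and then it contributes `S σ τ`. By `sum_S_commute_eq_card_sqrt`
these signs add up to the number of square roots of σ, so the scalar product becomes the average of
θ(ρ²), the Frobenius–Schur indicator. It is ±1 because characters of the symmetric group are
self-inverse, and it is a multiplicity, hence not negative; so it is 1.

For the count, note that τ permutes the σ-cycles. On a stable cycle of even length 2m it is the
identity or σ^m, and switching between the two reverses the sign (`S_toggle`), so all τ with such a
cycle cancel. Each remaining τ fixes its stable cycles pointwise, these being odd, and has sign 1.
It corresponds to one square root ρ of σ: two cycles exchanged by τ interlace to one cycle of ρ, and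
on a fixed odd cycle ρ is a power of σ.

The decomposition by length only partitions the basis. -/

/-! ### The flip of the tensor square and the Frobenius–Schur indicator. -/

namespace LinearMap

open TensorProduct in
/-- Composing `f ⊗ g` with the flip of the two factors yields a map of trace `tr (f g)`. -/
theorem trace_comm_comp_map {k V : Type*} [Field k] [AddCommGroup V] [Module k V]
    [FiniteDimensional k V] (f g : V →ₗ[k] V) :
    trace k (V ⊗[k] V) ((TensorProduct.comm k V V).toLinearMap ∘ₗ TensorProduct.map f g) =
      trace k V (f ∘ₗ g) := by
  classical
  let b := Module.finBasis k V
  rw [trace_eq_matrix_trace k (b.tensorProduct b), trace_eq_matrix_trace k b, toMatrix_comp b b b]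
  simp only [Matrix.trace, Matrix.diag, Matrix.mul_apply, toMatrix_apply, Fintype.sum_prod_type]
  refine Finset.sum_comm.trans (Finset.sum_congr rfl fun i _ => Finset.sum_congr rfl fun j _ => ?_)
  simp [Module.Basis.tensorProduct_repr_tmul_apply]

end LinearMap

open scoped TensorProduct

namespace Representation

section FrobeniusSchur

variable {G k V : Type*} [Group G] [Field k] [IsAlgClosed k] [CharZero k] [AddCommGroup V]
  [Module k V]
  [FiniteDimensional k V] [Fintype G] [Invertible (Nat.card G : k)]

/-- The Frobenius–Schur indicator of an irreducible representation with self-inverse character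
is `1` or `-1`. -/
theorem frobeniusSchur_eq_one_or_neg_one (ρ : Representation k G V) [ρ.IsIrreducible]
    (hρ : ∀ g, ρ.character g⁻¹ = ρ.character g) :
    (Nat.card G : k)⁻¹ * ∑ g : G, ρ.character (g * g) = 1 ∨
      (Nat.card G : k)⁻¹ * ∑ g : G, ρ.character (g * g) = -1 := by
  have : Invertible (Fintype.card G : k) := by rw [Fintype.card_eq_nat_card]; assumption
  -- Since the character is self-inverse, the average of χ² is the scalar product of χ with itself.
  have hfin : ((Module.finrank k (tprod ρ ρ).invariants : ℕ) : k) = 1 := by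
    rw [← card_inv_mul_sum_char_eq_finrank, char_tensor]
    have h := char_orthonormal ρ ρ
    rw [if_pos ⟨Equiv.refl ρ⟩] at h
    simpa [hρ] using h
  have htr : LinearMap.trace k _ (tprod ρ ρ).averageMap = 1 := by
    rw [(isProj_averageMap (tprod ρ ρ)).trace, hfin]
  let c : V ⊗[k] V →ₗ[k] V ⊗[k] V := (_root_.TensorProduct.comm k V V).toLinearMap
  have hcomm : ∀ g x, tprod ρ ρ g (c x) = c (tprod ρ ρ g x) := fun g x =>
    (IntertwiningMap.isIntertwining _ _ (TensorProduct.comm ρ ρ).toIntertwiningMap g x).symm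
  have hcc : ∀ x, c (c x) = x := fun x => (_root_.TensorProduct.comm k V V).symm_apply_apply x
  have hsum : LinearMap.trace k _ (c ∘ₗ (tprod ρ ρ).averageMap) =
      (Nat.card G : k)⁻¹ * ∑ g : G, ρ.character (g * g) := by
    have : (tprod ρ ρ).averageMap = (Nat.card G : k)⁻¹ • ∑ g : G, tprod ρ ρ g := by
      simp [GroupAlgebra.average, _root_.map_sum]
    rw [this, LinearMap.comp_smul, map_smul, smul_eq_mul, ← Module.End.mul_eq_comp, Finset.mul_sum,
      _root_.map_sum]
    congr 1
    refine Finset.sum_congr rfl fun g _ => ?_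
    rw [character, map_mul ρ g g, Module.End.mul_eq_comp (ρ g), ← LinearMap.trace_comm_comp_map]
    rfl
  -- The flip preserves the line of invariants, so it acts there by a scalar ε with ε² = 1. As
  -- averaging projects onto this line, the trace computed in `hsum` is ε.
  obtain ⟨y, hy0, hy⟩ := finrank_eq_one_iff'.1 (Nat.cast_eq_one.1 hfin)
  obtain ⟨ε, hε⟩ := hy ⟨c y, fun g => by rw [hcomm, y.2 g]⟩
  have hε' : c y = ε • (y : V ⊗[k] V) := (congrArg Subtype.val hε).symm
  have hεε : ε * ε = 1 := by
    have h := hcc y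
    rw [hε', map_smul, hε', smul_smul] at h
    have h0 : (y : V ⊗[k] V) ≠ 0 := fun h => hy0 (Subtype.ext h)
    refine smul_left_injective k h0 ?_
    simpa using h
  have hcP : c ∘ₗ (tprod ρ ρ).averageMap = ε • (tprod ρ ρ).averageMap := by
    refine LinearMap.ext fun x => ?_
    obtain ⟨a, ha⟩ := hy ⟨_, (tprod ρ ρ).averageMap_invariant x⟩
    have ha' : (tprod ρ ρ).averageMap x = a • (y : V ⊗[k] V) := (congrArg Subtype.val ha).symm
    rw [LinearMap.comp_apply, LinearMap.smul_apply, ha', map_smul, hε', smul_comm]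
  rw [← hsum, hcP, map_smul, htr, smul_eq_mul, mul_one]
  exact mul_self_eq_one_iff.1 hεε

end FrobeniusSchur

/-! ### Maschke's theorem and the character criterion for Gelfand models. -/

/-- The orbit of a nonzero vector is finite and spans a nonzero subrepresentation. This is needed
because a Gelfand model is tested against irreducibles of arbitrary dimension. -/
theorem IsIrreducible.finiteDimensional {G k V : Type*} [Group G] [Finite G] [Field k]
    [AddCommGroup V] [Module k V] (ρ : Representation k G V) [ρ.IsIrreducible] :
    FiniteDimensional k V := by
  obtain ⟨v, hv⟩ : ∃ v : V, v ≠ 0 := by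
    by_contra! h
    refine (bot_ne_top : (⊥ : Subrepresentation ρ) ≠ ⊤) (SetLike.ext fun v => ?_)
    rw [h v]
    exact iff_of_true (zero_mem (⊥ : Submodule k V)) (zero_mem (⊤ : Submodule k V))
  let S : Subrepresentation ρ :=
    { toSubmodule := Submodule.span k (Set.range fun g => ρ g v)
      apply_mem_toSubmodule := fun g w hw => by
        induction hw using Submodule.span_induction with
        | mem x hx =>
          obtain ⟨h, rfl⟩ := hx
          exact Submodule.subset_span ⟨g * h, by simp⟩
        | zero => simp
        | add x y _ _ hx hy => rw [map_add]; exact Submodule.add_mem _ hx hy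
        | smul c x _ hx => rw [map_smul]; exact Submodule.smul_mem _ _ hx }
  have hS : S ≠ ⊥ := fun h => hv <| by
    have : v ∈ S := Submodule.subset_span ⟨1, by simp⟩
    rw [h] at this
    exact (Submodule.mem_bot k).1 this
  have hT : (⊤ : Submodule k V) = Submodule.span k (Set.range fun g => ρ g v) :=
    (congrArg Subrepresentation.toSubmodule ((eq_bot_or_eq_top S).resolve_left hS)).symm
  exact ⟨by rw [hT]; exact Submodule.fg_span (Set.finite_range _)⟩

/-- An atom of the lattice of subrepresentations is irreducible. -/
theorem isIrreducible_toRepresentation {G k V : Type*} [Group G] [Field k] [AddCommGroup V]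
    [Module k V] {ρ : Representation k G V} {U : Subrepresentation ρ} (hU : IsAtom U) :
    U.toRepresentation.IsIrreducible := by
  have hbot : (⊥ : Subrepresentation U.toRepresentation) ≠ ⊤ := fun h => hU.1 <| by
    refine SetLike.ext fun v => ⟨fun hv => ?_, fun hv => ?_⟩
    · have h1 : (⟨v, hv⟩ : U.toSubmodule) ∈ (⊤ : Subrepresentation U.toRepresentation) :=
        Submodule.mem_top (R := k)
      rw [← h] at h1
      exact (Submodule.mem_bot k).2 (congrArg Subtype.val ((Submodule.mem_bot k).1 h1))
    · rw [(Submodule.mem_bot k).1 hv]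
      exact U.toSubmodule.zero_mem
  refine { exists_pair_ne := ⟨⊥, ⊤, hbot⟩, eq_bot_or_eq_top := fun S => ?_ }
  let T : Subrepresentation ρ :=
    { toSubmodule := S.toSubmodule.map U.toSubmodule.subtype
      apply_mem_toSubmodule := by
        rintro g _ ⟨w, hw, rfl⟩
        exact ⟨U.toRepresentation g w, S.apply_mem_toSubmodule g hw, rfl⟩ }
  have hTU : T ≤ U := by
    rintro _ ⟨w, -, rfl⟩
    exact w.2
  have hmem : ∀ w : U.toSubmodule, w ∈ S ↔ (w : V) ∈ T := fun w =>
    ⟨fun hw => ⟨w, hw, rfl⟩, by rintro ⟨w', hw', h⟩; rwa [← Subtype.ext h]⟩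
  rcases hU.le_iff.1 hTU with h | h
  · refine Or.inl (SetLike.ext fun w => (hmem w).trans ?_)
    rw [h]
    exact (Submodule.mem_bot k).trans
      (Subtype.ext_iff.symm.trans (Submodule.mem_bot (R := k) (x := w)).symm)
  · refine Or.inr (SetLike.ext fun w => (hmem w).trans ?_)
    rw [h]
    exact iff_of_true w.2 (Submodule.mem_top (R := k))

/-- Maschke's theorem: a finite-dimensional representation of a finite group is a finite internal
direct sum of irreducible subrepresentations. -/
theorem exists_isInternal_isIrreducible {G k V : Type*} [Group G] [Finite G] [Field k]
    [NeZero (Nat.card G : k)] [AddCommGroup V] [Module k V] [FiniteDimensional k V]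
    (ρ : Representation k G V) :
    ∃ (n : ℕ) (U : Fin n → Subrepresentation ρ),
      DirectSum.IsInternal (fun i => (U i).toSubmodule) ∧
      ∀ i, (U i).toRepresentation.IsIrreducible := by
  classical
  have : IsSemisimpleModule (MonoidAlgebra k G) ρ.asModule :=
    (isSemisimpleRepresentation_iff_isSemisimpleModule_asModule ρ).1 inferInstance
  have : Module.Finite (MonoidAlgebra k G) ρ.asModule :=
    have : Module.Finite k ρ.asModule := inferInstanceAs (Module.Finite k V)
    Module.Finite.of_restrictScalars_finite k _ _
  obtain ⟨s, hs, hs', hsimp⟩ :=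
    IsSemisimpleModule.exists_sSupIndep_sSup_simples_eq_top (MonoidAlgebra k G) ρ.asModule
  -- The ascending chain condition rules out an infinite independent family.
  have hfin : s.Finite := WellFoundedGT.finite_of_sSupIndep hs
  have := hfin.fintype
  let e := (Fintype.equivFin s).symm
  refine ⟨Fintype.card s, fun i => Subrepresentation.ofSubmodule' (e i).1, ?_, fun i => ?_⟩
  · have : DirectSum.IsInternal fun i => (e i).1 := by
      rw [DirectSum.isInternal_submodule_iff_iSupIndep_and_iSup_eq_top]
      refine ⟨((sSupIndep_iff s).1 hs).comp e.injective, ?_⟩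
      rw [e.iSup_comp (g := fun x : s => x.1), ← sSup_eq_iSup', hs']
    exact this
  · have hsim := hsimp _ (e i).2
    rw [isSimpleModule_iff_isAtom] at hsim
    refine isIrreducible_toRepresentation ?_
    exact (Subrepresentation.subrepresentationSubmoduleOrderIso.symm.isAtom_iff _).2 hsim

open scoped Classical in
/-- A representation is a Gelfand model if every irreducible character has scalar product `1`
with its character. -/
theorem isGelfandModel_of_inner_character_eq_one {G : Type u} [Group G] [Fintype G] {V : Type v}
    [AddCommGroup V] [Module ℂ V] [FiniteDimensional ℂ V] (ρ : Representation ℂ G V)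
    (h : ∀ (W : Type w) [AddCommGroup W] [Module ℂ W] [FiniteDimensional ℂ W]
      (θ : Representation ℂ G W), θ.IsIrreducible →
        (Nat.card G : ℂ)⁻¹ * ∑ g : G, ρ.character g * θ.character g⁻¹ = 1) :
    IsGelfandModel.{u, v, w} ρ := by
  have : Invertible (Nat.card G : ℂ) := invertibleOfNonzero (by simp)
  have : NeZero (Nat.card G : ℂ) := ⟨by simp⟩
  obtain ⟨n, U, hU, hirr⟩ := exists_isInternal_isIrreducible ρ
  refine ⟨n, U, hU, hirr, fun W _ _ θ hθ => ?_⟩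
  have := IsIrreducible.finiteDimensional θ
  have hchar : ∀ g, ρ.character g = ∑ i, (U i).toRepresentation.character g := fun g =>
    LinearMap.trace_eq_sum_trace_restrict hU fun i => (U i).apply_mem_toSubmodule g
  have hsum := h W θ hθ
  simp_rw [hchar, Finset.sum_mul] at hsum
  rw [Finset.sum_comm, Finset.mul_sum] at hsum
  have horth : ∀ i, (Nat.card G : ℂ)⁻¹ * ∑ g : G,
      (U i).toRepresentation.character g * θ.character g⁻¹ =
        if Nonempty ((U i).toRepresentation.Equiv θ) then 1 else 0 := fun i => by
    have := hirr i
    rw [char_orthonormal]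
    exact if_congr ⟨fun ⟨e⟩ => ⟨e.symm⟩, fun ⟨e⟩ => ⟨e.symm⟩⟩ rfl rfl
  -- The scalar product counts the summands isomorphic to θ.
  simp_rw [horth, Finset.sum_boole] at hsum
  obtain ⟨i, hi⟩ := Finset.card_eq_one.1 (Nat.cast_eq_one.1 hsum)
  refine ⟨i, ?_, fun j hj => ?_⟩
  · have : i ∈ Finset.univ.filter fun i => Nonempty ((U i).toRepresentation.Equiv θ) := by
      rw [hi]; simp
    simpa using this
  · have : j ∈ Finset.univ.filter fun i => Nonempty ((U i).toRepresentation.Equiv θ) := by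
      simpa using hj
    simpa [hi] using this

end Representation

/-! ### Signs computed along transversals of the orbits of τ. -/

namespace Involutions

open Equiv.Perm Finset

variable {N : ℕ}

/-- `1` if `p` is the smaller element of its `τ`-orbit of size two, and `-1` otherwise. -/
noncomputable def orient (τ : Involutions N) (p : Fin N) : ℂ := if p < τ.1 p then 1 else -1

lemma orient_mul_self (τ : Involutions N) (p : Fin N) : τ.orient p * τ.orient p = 1 := by
  unfold orient; split_ifs <;> norm_num

lemma orient_apply {τ : Involutions N} {p : Fin N} (h : τ.1 p ≠ p) :
    τ.orient (τ.1 p) = -τ.orient p := by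
  unfold orient
  rw [apply_apply]
  rcases lt_or_gt_of_ne h with h | h
  · rw [if_pos h, if_neg (not_lt.2 h.le), neg_neg]
  · rw [if_pos h, if_neg (not_lt.2 h.le)]

lemma apply_comm {σ : Equiv.Perm (Fin N)} {τ : Involutions N} (hc : Commute σ τ.1) (p : Fin N) :
    τ.1 (σ p) = σ (τ.1 p) :=
  (congrArg (fun f : Equiv.Perm (Fin N) => f p) hc.eq).symm

lemma apply_zpow_comm {σ : Equiv.Perm (Fin N)} {τ : Involutions N} (hc : Commute σ τ.1) (i : ℤ)
    (p : Fin N) : τ.1 ((σ ^ i) p) = (σ ^ i) (τ.1 p) :=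
  (congrArg (fun f : Equiv.Perm (Fin N) => f p) (hc.zpow_left i).eq).symm

/-- For `σ` commuting with `τ`, the sign `S σ τ` may be computed along any transversal of the
two-element orbits of `τ`. -/
lemma S_eq_prod_transversal {σ : Equiv.Perm (Fin N)} {τ : Involutions N} (hc : Commute σ τ.1)
    (R : Finset (Fin N)) (hR : ∀ p ∈ R, τ.1 p ∉ R) (hR' : ∀ p, τ.1 p ≠ p → p ∈ R ∨ τ.1 p ∈ R) :
    S σ τ = ∏ p ∈ R, τ.orient p * τ.orient (σ p) := by
  have hne : ∀ p ∈ R, τ.1 p ≠ p := fun p hp h => hR p hp (by rwa [h])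
  have hσ : ∀ p, τ.1 p ≠ p → τ.1 (σ p) ≠ σ p := fun p hp h =>
    hp (σ.injective (by rw [← apply_comm hc, h]))
  have hE : ∀ p, p < τ.1 p → (if σ p > σ (τ.1 p) then (-1 : ℂ) else 1) =
      τ.orient p * τ.orient (σ p) := by
    intro p hp
    have h := hσ p hp.ne'
    unfold orient
    rw [if_pos hp, ← apply_comm hc, one_mul]
    rcases lt_or_gt_of_ne h with h | h
    · rw [if_pos h, if_neg (not_lt.2 h.le)]
    · rw [if_pos h, if_neg (not_lt.2 h.le)]
  -- Replacing p by τ p reverses both orientations, so the factor depends only on the orbit.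
  have hinv : ∀ p, τ.1 p ≠ p →
      τ.orient (τ.1 p) * τ.orient (σ (τ.1 p)) = τ.orient p * τ.orient (σ p) := by
    intro p hp
    rw [← apply_comm hc, orient_apply hp, orient_apply (hσ p hp), neg_mul_neg]
  rw [S_eq_prod]
  refine Finset.prod_bij' (fun p _ => if p ∈ R then p else τ.1 p)
    (fun q _ => if q < τ.1 q then q else τ.1 q) ?_ ?_ ?_ ?_ ?_
  · intro p hp
    have hp' : p < τ.1 p := by simpa using hp
    by_cases h : p ∈ R
    · simp only [h, if_true]
    · simpa only [h, if_false, false_or] using hR' p hp'.ne'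
  · intro q hq
    rcases lt_or_gt_of_ne (hne q hq) with h | h
    · simp [not_lt.2 h.le, apply_apply, h]
    · simp [h]
  · intro p hp
    have hp' : p < τ.1 p := by simpa using hp
    by_cases h : p ∈ R
    · simp [h, hp']
    · simp [h, apply_apply, hp'.le]
  · intro q hq
    rcases lt_or_gt_of_ne (hne q hq) with h | h
    · simp [not_lt.2 h.le, apply_apply, hR q hq]
    · simp [h, hq]
  · intro p hp
    have hp' : p < τ.1 p := by simpa using hp
    rw [hE p hp']
    by_cases h : p ∈ R
    · simp [h]
    · simp [h, hinv p hp'.ne']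

lemma pow_apply_eq_pow_apply_iff {σ : Equiv.Perm (Fin N)} {p : Fin N} {i j : ℕ}
    (hi : i < Function.minimalPeriod σ p) (hj : j < Function.minimalPeriod σ p) :
    (σ ^ i) p = (σ ^ j) p ↔ i = j := by
  rw [← iterate_eq_pow, ← iterate_eq_pow]
  exact Function.iterate_eq_iterate_iff_of_lt_minimalPeriod hi hj

lemma pow_apply_eq_self_iff {σ : Equiv.Perm (Fin N)} {p : Fin N} {i : ℕ} :
    (σ ^ i) p = p ↔ Function.minimalPeriod σ p ∣ i := by
  rw [← iterate_eq_pow]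
  exact Function.isPeriodicPt_iff_minimalPeriod_dvd

lemma minimalPeriod_pos (σ : Equiv.Perm (Fin N)) (p : Fin N) : 0 < Function.minimalPeriod σ p := by
  refine Nat.pos_of_dvd_of_pos (pow_apply_eq_self_iff.1 ?_) (orderOf_pos σ)
  rw [pow_orderOf_eq_one, one_apply]

lemma exists_pow_lt_minimalPeriod {σ : Equiv.Perm (Fin N)} {p q : Fin N} (h : SameCycle σ p q) :
    ∃ i < Function.minimalPeriod σ p, (σ ^ i) p = q := by
  obtain ⟨i, hi⟩ := h.exists_nat_pow_eq
  refine ⟨i % Function.minimalPeriod σ p, Nat.mod_lt _ (minimalPeriod_pos σ p), ?_⟩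
  rw [← iterate_eq_pow, Function.iterate_mod_minimalPeriod_eq, iterate_eq_pow, hi]

/-- If `τ₁` and `τ₂` commute with `σ` and differ only on a `σ`-cycle of even length `2 * m`, on
which `τ₁` is the identity and `τ₂` is `σ ^ m`, then they have opposite signs. -/
lemma S_eq_neg_of_eqOn_cycle {σ : Equiv.Perm (Fin N)} {τ₁ τ₂ : Involutions N}
    (h₁ : Commute σ τ₁.1) (h₂ : Commute σ τ₂.1) {p₀ : Fin N} {m : ℕ}
    (hm : Function.minimalPeriod σ p₀ = m + m)
    (hoff : ∀ p, ¬ SameCycle σ p₀ p → τ₁.1 p = τ₂.1 p)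
    (hon₁ : ∀ p, SameCycle σ p₀ p → τ₁.1 p = p)
    (hon₂ : ∀ p, SameCycle σ p₀ p → τ₂.1 p = (σ ^ m) p) :
    S σ τ₂ = -S σ τ₁ := by
  have hm0 : 0 < m := by have := minimalPeriod_pos σ p₀; omega
  have hpow : ∀ i, SameCycle σ p₀ ((σ ^ i) p₀) := fun i => ⟨i, by simp⟩
  have hsc : ∀ p, SameCycle σ p₀ (τ₁.1 p) ↔ SameCycle σ p₀ p := by
    intro p
    refine ⟨fun h => ?_, fun h => by rwa [hon₁ p h]⟩
    have := hon₁ _ h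
    rw [apply_apply] at this
    rwa [this]
  have hsc₂ : ∀ p, SameCycle σ p₀ (τ₂.1 p) ↔ SameCycle σ p₀ p := by
    intro p
    by_cases h : SameCycle σ p₀ p
    · rw [hon₂ p h, sameCycle_pow_right]
    · rw [← hoff p h, hsc]
  let E := univ.filter fun p : Fin N => p < τ₁.1 p
  have hE : ∀ p, p ∈ E ↔ p < τ₁.1 p := fun p => by simp [E]
  have hEoff : ∀ p ∈ E, ¬ SameCycle σ p₀ p := fun p hp h =>
    ((hE p).1 hp).ne (hon₁ p h).symm
  -- The first half of the cycle is a transversal for the pairs {p, σ^m p}.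
  let C := (range m).image fun i => (σ ^ i) p₀
  have hC : ∀ p, p ∈ C ↔ ∃ i < m, (σ ^ i) p₀ = p := fun p => by simp [C]
  have hCon : ∀ p ∈ C, SameCycle σ p₀ p := fun p hp => by
    obtain ⟨i, -, rfl⟩ := (hC p).1 hp
    exact hpow i
  have hτpow : ∀ i, τ₂.1 ((σ ^ i) p₀) = (σ ^ (m + i)) p₀ := fun i => by
    rw [hon₂ _ (hpow i), pow_add, mul_apply]
  have hτ₁ : S σ τ₁ = ∏ p ∈ E, τ₁.orient p * τ₁.orient (σ p) := by
    refine S_eq_prod_transversal h₁ E (fun p hp hp' => ?_) fun p hp => ?_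
    · rw [hE] at hp hp'
      rw [apply_apply] at hp'
      exact lt_asymm hp hp'
    · rw [hE, hE, apply_apply]
      exact (lt_or_gt_of_ne hp).symm
  have hdisj : Disjoint E C := Finset.disjoint_left.2 fun p hp hp' => hEoff p hp (hCon p hp')
  have hτ₂ : S σ τ₂ = ∏ p ∈ E ∪ C, τ₂.orient p * τ₂.orient (σ p) := by
    refine S_eq_prod_transversal h₂ _ (fun p hp hp' => ?_) fun p hp => ?_
    · rcases mem_union.1 hp with hp | hp <;> rcases mem_union.1 hp' with hp' | hp'
      · rw [← hoff p (hEoff p hp)] at hp'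
        rw [hE] at hp hp'
        rw [apply_apply] at hp'
        exact lt_asymm hp hp'
      · exact hEoff p hp ((hsc₂ p).1 (hCon _ hp'))
      · exact hEoff _ hp' ((hsc₂ p).2 (hCon _ hp))
      · obtain ⟨i, hi, rfl⟩ := (hC p).1 hp
        rw [hτpow] at hp'
        obtain ⟨j, hj, hij⟩ := (hC _).1 hp'
        have := (pow_apply_eq_pow_apply_iff (by omega) (by omega)).1 hij
        omega
    · simp only [mem_union]
      by_cases h : SameCycle σ p₀ p
      · obtain ⟨i, hi, rfl⟩ := exists_pow_lt_minimalPeriod h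
        by_cases him : i < m
        · exact Or.inl (Or.inr ((hC _).2 ⟨i, him, rfl⟩))
        · refine Or.inr (Or.inr ((hC _).2 ⟨i - m, by omega, ?_⟩))
          have h0 : (σ ^ (m + m)) p₀ = p₀ := pow_apply_eq_self_iff.2 (by rw [hm])
          rw [hτpow, show m + i = (i - m) + (m + m) by omega, pow_add, mul_apply, h0]
      · rw [← hoff p h] at hp ⊢
        rcases lt_or_gt_of_ne hp with h' | h'
        · exact Or.inr (Or.inl ((hE _).2 (by rwa [apply_apply])))
        · exact Or.inl (Or.inl ((hE _).2 h'))
  have horient : ∀ p, ¬ SameCycle σ p₀ p → τ₂.orient p = τ₁.orient p := fun p hp => by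
    unfold orient; rw [hoff p hp]
  -- The product telescopes. For n = m its endpoints are p₀ and τ₂ p₀, whose orientations are
  -- opposite: this is the extra sign.
  have htel : ∀ n, ∏ i ∈ range n, τ₂.orient ((σ ^ i) p₀) * τ₂.orient (σ ((σ ^ i) p₀)) =
      τ₂.orient p₀ * τ₂.orient ((σ ^ n) p₀) := fun n => by
    induction n with
    | zero => simp [orient_mul_self]
    | succ n ih =>
      rw [prod_range_succ, ih, mul_mul_mul_comm, mul_comm (τ₂.orient p₀),
        mul_mul_mul_comm, orient_mul_self, one_mul, pow_succ', mul_apply]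
  have hinj : Set.InjOn (fun i => (σ ^ i) p₀) (range m) := fun i hi j hj hij => by
    have hi' := mem_range.1 (mem_coe.1 hi)
    have hj' := mem_range.1 (mem_coe.1 hj)
    exact (pow_apply_eq_pow_apply_iff (by omega) (by omega)).1 hij
  have hne : τ₂.1 p₀ ≠ p₀ := by
    rw [hon₂ p₀ (SameCycle.refl _ _), Ne, pow_apply_eq_self_iff, hm]
    exact fun h => by have := Nat.le_of_dvd hm0 h; omega
  rw [hτ₂, prod_union hdisj, prod_image hinj, htel, ← hon₂ p₀ (SameCycle.refl _ _),
    orient_apply hne, mul_neg, orient_mul_self, mul_neg_one, hτ₁]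
  refine congrArg _ (prod_congr rfl fun p hp => ?_)
  have := hEoff p hp
  rw [horient p this, horient (σ p) (by rwa [sameCycle_apply_right])]

end Involutions

/-! ### The sign-reversing involution on stable even cycles. -/

namespace Involutions

open Equiv.Perm Finset

variable {N : ℕ}

/-- The points lying on a `σ`-cycle of even length that is stable under `τ`. -/
noncomputable def evenStable (σ : Equiv.Perm (Fin N)) (τ : Involutions N) : Finset (Fin N) :=
  open Classical in
  univ.filter fun p => SameCycle σ p (τ.1 p) ∧ Even (Function.minimalPeriod σ p)

lemma mem_evenStable {σ : Equiv.Perm (Fin N)} {τ : Involutions N} {p : Fin N} :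
    p ∈ evenStable σ τ ↔ SameCycle σ p (τ.1 p) ∧ Even (Function.minimalPeriod σ p) := by
  simp [evenStable]

lemma sameCycle_apply_apply_iff {σ : Equiv.Perm (Fin N)} {τ : Involutions N}
    (hc : Commute σ τ.1) {p q : Fin N} : SameCycle σ (τ.1 p) (τ.1 q) ↔ SameCycle σ p q := by
  refine exists_congr fun i => ?_
  rw [← apply_zpow_comm hc, EmbeddingLike.apply_eq_iff_eq]

lemma sameCycle_apply_iff_of_stable {σ : Equiv.Perm (Fin N)} {τ : Involutions N}
    (hc : Commute σ τ.1) {p₀ p : Fin N} (h₀ : SameCycle σ p₀ (τ.1 p₀)) :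
    SameCycle σ p₀ (τ.1 p) ↔ SameCycle σ p₀ p := by
  rw [← sameCycle_apply_apply_iff hc (p := p₀) (q := p)]
  exact ⟨h₀.symm.trans, h₀.trans⟩

lemma pow_apply_eq_self_of_sameCycle {σ : Equiv.Perm (Fin N)} {p q : Fin N} {n : ℕ}
    (h : SameCycle σ p q) (hp : (σ ^ n) p = p) : (σ ^ n) q = q := by
  obtain ⟨i, rfl⟩ := h
  rw [← mul_apply, ← zpow_natCast, ← zpow_add, add_comm, zpow_add, mul_apply, zpow_natCast, hp]

/-- Multiply `τ` by `σ ^ m` on the `σ`-cycle of `p₀`. -/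
noncomputable def toggle (σ : Equiv.Perm (Fin N)) (τ : Involutions N) (hc : Commute σ τ.1)
    (p₀ : Fin N) (h₀ : SameCycle σ p₀ (τ.1 p₀)) (m : ℕ) (hm : (σ ^ (m + m)) p₀ = p₀) :
    Involutions N :=
  open Classical in
  have hinv : Function.Involutive fun p : Fin N =>
      if SameCycle σ p₀ p then (σ ^ m) (τ.1 p) else τ.1 p := fun p => by
    have h1 := sameCycle_apply_iff_of_stable hc (p := p) h₀
    have h2 : τ.1 ((σ ^ m) (τ.1 p)) = (σ ^ m) p := by
      have := apply_zpow_comm hc m (τ.1 p)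
      rwa [apply_apply, zpow_natCast] at this
    by_cases h : SameCycle σ p₀ p
    · simp only [h, if_true, sameCycle_pow_right, h1, h2]
      rw [← mul_apply, ← pow_add]
      exact pow_apply_eq_self_of_sameCycle h hm
    · simp only [h, if_false, h1, apply_apply]
  ⟨hinv.toPerm, Equiv.ext hinv⟩

section Toggle

variable {σ : Equiv.Perm (Fin N)} {τ : Involutions N} (hc : Commute σ τ.1)
  {p₀ : Fin N} (h₀ : SameCycle σ p₀ (τ.1 p₀)) {m : ℕ} (hm : (σ ^ (m + m)) p₀ = p₀)

lemma toggle_apply_of_sameCycle {p : Fin N} (h : SameCycle σ p₀ p) :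
    (toggle σ τ hc p₀ h₀ m hm).1 p = (σ ^ m) (τ.1 p) :=
  if_pos h

lemma toggle_apply_of_not_sameCycle {p : Fin N} (h : ¬ SameCycle σ p₀ p) :
    (toggle σ τ hc p₀ h₀ m hm).1 p = τ.1 p :=
  if_neg h

lemma commute_toggle : Commute σ (toggle σ τ hc p₀ h₀ m hm).1 := by
  refine Equiv.ext fun p => ?_
  rw [mul_apply, mul_apply]
  by_cases h : SameCycle σ p₀ p
  · rw [toggle_apply_of_sameCycle hc h₀ hm h,
      toggle_apply_of_sameCycle hc h₀ hm (sameCycle_apply_right.2 h), apply_comm hc]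
    change (σ * σ ^ m) _ = (σ ^ m * σ) _
    rw [← pow_succ', ← pow_succ]
  · rw [toggle_apply_of_not_sameCycle hc h₀ hm h,
      toggle_apply_of_not_sameCycle hc h₀ hm (mt sameCycle_apply_right.1 h), apply_comm hc]

lemma sameCycle_toggle_iff {p q : Fin N} :
    SameCycle σ q ((toggle σ τ hc p₀ h₀ m hm).1 p) ↔ SameCycle σ q (τ.1 p) := by
  by_cases h : SameCycle σ p₀ p
  · rw [toggle_apply_of_sameCycle hc h₀ hm h, sameCycle_pow_right]
  · rw [toggle_apply_of_not_sameCycle hc h₀ hm h]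

/-- Toggling moves images only within their σ-cycle. Hence a cycle selected from `evenStable` is
selected again after toggling. -/
lemma evenStable_toggle : evenStable σ (toggle σ τ hc p₀ h₀ m hm) = evenStable σ τ := by
  ext p
  rw [mem_evenStable, mem_evenStable, sameCycle_toggle_iff]

lemma toggle_toggle (hc' : Commute σ (toggle σ τ hc p₀ h₀ m hm).1)
    (h₀' : SameCycle σ p₀ ((toggle σ τ hc p₀ h₀ m hm).1 p₀)) :
    toggle σ (toggle σ τ hc p₀ h₀ m hm) hc' p₀ h₀' m hm = τ := by
  refine Subtype.ext (Equiv.ext fun p => ?_)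
  by_cases h : SameCycle σ p₀ p
  · rw [toggle_apply_of_sameCycle _ _ hm h, toggle_apply_of_sameCycle hc h₀ hm h,
      ← mul_apply, ← pow_add]
    exact pow_apply_eq_self_of_sameCycle
      ((sameCycle_apply_iff_of_stable hc h₀).2 h) hm
  · rw [toggle_apply_of_not_sameCycle _ _ hm h, toggle_apply_of_not_sameCycle hc h₀ hm h]

/-- Commuting with σ, τ agrees on the whole stable cycle with a single power σ^j, where j < 2m.
Being an involution forces 2m to divide 2j, so j is 0 or m, and toggling exchanges these two cases.
-/
lemma S_toggle (hp : Function.minimalPeriod σ p₀ = m + m) :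
    S σ (toggle σ τ hc p₀ h₀ m hm) = -S σ τ := by
  have hspread : ∀ n, τ.1 p₀ = (σ ^ n) p₀ → ∀ p, SameCycle σ p₀ p → τ.1 p = (σ ^ n) p := by
    rintro n hn _ ⟨i, rfl⟩
    rw [apply_zpow_comm hc, hn, ← mul_apply, ← mul_apply, ← zpow_natCast, ← zpow_add, ← zpow_add,
      add_comm]
  obtain ⟨j, hj, hjp⟩ := exists_pow_lt_minimalPeriod h₀
  have hjj : (σ ^ (j + j)) p₀ = p₀ := by
    rw [pow_add, mul_apply, hjp, ← hspread j hjp.symm _ h₀, apply_apply]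
  obtain ⟨t, ht⟩ := pow_apply_eq_self_iff.1 hjj
  rw [hp] at ht hj
  have htj : j = m * t := by nlinarith
  have ht2 : t < 2 := by nlinarith
  interval_cases t
  · have hid : ∀ p, SameCycle σ p₀ p → τ.1 p = p := by
      simpa [htj] using hspread j hjp.symm
    refine S_eq_neg_of_eqOn_cycle hc (commute_toggle hc h₀ hm) hp
      (fun p h => (toggle_apply_of_not_sameCycle hc h₀ hm h).symm) hid fun p h => ?_
    rw [toggle_apply_of_sameCycle hc h₀ hm h, hid p h]
  · have hid : ∀ p, SameCycle σ p₀ p → τ.1 p = (σ ^ m) p := by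
      simpa [htj] using hspread j hjp.symm
    rw [S_eq_neg_of_eqOn_cycle (commute_toggle hc h₀ hm) hc hp
      (fun p h => toggle_apply_of_not_sameCycle hc h₀ hm h) (fun p h => ?_) hid, neg_neg]
    rw [toggle_apply_of_sameCycle hc h₀ hm h, hid p h, ← mul_apply, ← pow_add]
    exact pow_apply_eq_self_of_sameCycle h hm

end Toggle

/-- The second toggle selects its base point and half-length afresh; they equal the first ones only
propositionally. -/
lemma toggle_toggle_of_eq {σ : Equiv.Perm (Fin N)} {τ : Involutions N} (hc : Commute σ τ.1)
    {p₀ p₁ : Fin N} (h₀ : SameCycle σ p₀ (τ.1 p₀)) {m n : ℕ} (hm : (σ ^ (m + m)) p₀ = p₀)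
    (hc' : Commute σ (toggle σ τ hc p₀ h₀ m hm).1)
    (h₁ : SameCycle σ p₁ ((toggle σ τ hc p₀ h₀ m hm).1 p₁)) (hn : (σ ^ (n + n)) p₁ = p₁)
    (hp : p₁ = p₀) (hmn : n = m) :
    toggle σ (toggle σ τ hc p₀ h₀ m hm) hc' p₁ h₁ n hn = τ := by
  subst hp hmn
  exact toggle_toggle hc h₀ hm hc' h₁

/-- The involutions commuting with `σ` that stabilize a `σ`-cycle of even length contribute zero
to the sum of the signs. -/
lemma sum_S_evenStable_nonempty (σ : Equiv.Perm (Fin N)) [DecidablePred fun τ : Involutions N =>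
      Commute σ τ.1 ∧ (evenStable σ τ).Nonempty] :
    ∑ τ ∈ univ.filter fun τ : Involutions N => Commute σ τ.1 ∧ (evenStable σ τ).Nonempty,
      S σ τ = 0 := by
  have hmem : ∀ τ : Involutions N, τ ∈ univ.filter
      (fun τ : Involutions N => Commute σ τ.1 ∧ (evenStable σ τ).Nonempty) ↔
        Commute σ τ.1 ∧ (evenStable σ τ).Nonempty := fun τ => by simp
  let m : Fin N → ℕ := fun p => Function.minimalPeriod σ p / 2
  have hper : ∀ p, Even (Function.minimalPeriod σ p) →
      Function.minimalPeriod σ p = m p + m p := fun p hp => by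
    obtain ⟨n, hn⟩ := hp
    simp only [m]
    omega
  have hself : ∀ p, Even (Function.minimalPeriod σ p) → (σ ^ (m p + m p)) p = p := fun p hp =>
    pow_apply_eq_self_iff.2 (dvd_of_eq (hper p hp))
  have hmin : ∀ (τ : Involutions N) (h : (evenStable σ τ).Nonempty),
      SameCycle σ ((evenStable σ τ).min' h) (τ.1 ((evenStable σ τ).min' h)) ∧
        Even (Function.minimalPeriod σ ((evenStable σ τ).min' h)) := fun τ h =>
    mem_evenStable.1 (Finset.min'_mem _ h)
  have hmin_eq : ∀ (s t : Finset (Fin N)) (hs : s.Nonempty) (ht : t.Nonempty), s = t →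
      s.min' hs = t.min' ht := by
    rintro s t hs ht rfl; rfl
  -- The cycle to toggle is that of the least point of `evenStable`, a choice depending on this set
  -- alone.
  let g : ∀ τ ∈ univ.filter
      (fun τ : Involutions N => Commute σ τ.1 ∧ (evenStable σ τ).Nonempty), Involutions N :=
    fun τ hτ =>
      have h := (hmem τ).1 hτ
      toggle σ τ h.1 ((evenStable σ τ).min' h.2) (hmin τ h.2).1 _ (hself _ (hmin τ h.2).2)
  have hgB : ∀ τ hτ, evenStable σ (g τ hτ) = evenStable σ τ := fun τ hτ => evenStable_toggle ..
  have hgS : ∀ τ hτ, S σ (g τ hτ) = -S σ τ := fun τ hτ =>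
    S_toggle _ _ _ (hper _ (hmin τ ((hmem τ).1 hτ).2).2)
  have hg_mem : ∀ τ hτ, g τ hτ ∈ univ.filter
      (fun τ : Involutions N => Commute σ τ.1 ∧ (evenStable σ τ).Nonempty) := fun τ hτ => by
    rw [hmem, hgB _ hτ]
    exact ⟨commute_toggle _ _ _, ((hmem τ).1 hτ).2⟩
  refine Finset.sum_involution g (fun τ hτ => ?_) (fun τ hτ h => ?_) hg_mem fun τ hτ => ?_
  · rw [hgS τ hτ, add_neg_cancel]
  · intro h'
    have := hgS τ hτ
    rw [h'] at this
    exact h (self_eq_neg.1 this)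
  · have hpq := hmin_eq _ _ ((hmem _).1 (hg_mem τ hτ)).2 ((hmem τ).1 hτ).2 (hgB τ hτ)
    exact toggle_toggle_of_eq _ _ _ _ _ _ hpq (congrArg m hpq)

end Involutions

/-! ### The remaining involutions and the square roots of σ. -/

namespace Involutions

open Equiv.Perm Finset

variable {N : ℕ}

/-- A label of the `σ`-cycle of a point. -/
noncomputable def cycleKey (σ : Equiv.Perm (Fin N)) (p : Fin N) : Fin N :=
  (Quotient.mk (SameCycle.setoid σ) p).out

lemma cycleKey_eq_iff {σ : Equiv.Perm (Fin N)} {p q : Fin N} :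
    cycleKey σ p = cycleKey σ q ↔ SameCycle σ p q :=
  Quotient.out_inj.trans Quotient.eq

lemma cycleKey_apply (σ : Equiv.Perm (Fin N)) (p : Fin N) : cycleKey σ (σ p) = cycleKey σ p :=
  cycleKey_eq_iff.2 (sameCycle_apply_left.2 (SameCycle.refl _ _))

lemma cycleKey_pow_apply (σ : Equiv.Perm (Fin N)) (n : ℕ) (p : Fin N) :
    cycleKey σ ((σ ^ n) p) = cycleKey σ p :=
  cycleKey_eq_iff.2 (sameCycle_pow_left.2 (SameCycle.refl _ _))

lemma notMem_evenStable_iff {σ : Equiv.Perm (Fin N)} {τ : Involutions N} {p : Fin N} :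
    p ∉ evenStable σ τ ↔
      (cycleKey σ (τ.1 p) = cycleKey σ p → Odd (Function.minimalPeriod σ p)) := by
  rw [mem_evenStable, cycleKey_eq_iff, sameCycle_comm, not_and, Nat.not_even_iff_odd]

/-- If τ p = σ^j p, then σ^(2j) p = p, and the odd period of p divides j. -/
lemma apply_eq_self_of_cycleKey_eq {σ : Equiv.Perm (Fin N)} {τ : Involutions N}
    (hc : Commute σ τ.1) (hτ : evenStable σ τ = ∅) {p : Fin N}
    (h : cycleKey σ (τ.1 p) = cycleKey σ p) : τ.1 p = p := by
  have hodd : Odd (Function.minimalPeriod σ p) :=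
    notMem_evenStable_iff.1 (by rw [hτ]; exact notMem_empty p) h
  obtain ⟨j, hj⟩ := (cycleKey_eq_iff.1 h.symm).exists_nat_pow_eq
  have hjj : (σ ^ (2 * j)) p = p := by
    have h2 := apply_zpow_comm hc j p
    rw [zpow_natCast] at h2
    rw [two_mul, pow_add, mul_apply, hj, ← h2, hj, apply_apply]
  have := (Nat.Coprime.dvd_mul_left (Nat.coprime_two_right.2 hodd)).1
    (pow_apply_eq_self_iff.1 hjj)
  rw [← hj, pow_apply_eq_self_iff.2 this]

/-- The points whose cycle has a smaller label than its image under τ form a transversal stable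
under σ. Reindexing by σ then makes every orientation occur squared. -/
lemma S_eq_one_of_evenStable_eq_empty {σ : Equiv.Perm (Fin N)} {τ : Involutions N}
    (hc : Commute σ τ.1) (hτ : evenStable σ τ = ∅) : S σ τ = 1 := by
  have hmem : ∀ p, p ∈ univ.filter (fun p => cycleKey σ p < cycleKey σ (τ.1 p)) ↔
      cycleKey σ p < cycleKey σ (τ.1 p) := fun p => by simp
  rw [S_eq_prod_transversal hc (univ.filter fun p => cycleKey σ p < cycleKey σ (τ.1 p)),
    prod_mul_distrib]
  · have : ∏ p ∈ univ.filter (fun p => cycleKey σ p < cycleKey σ (τ.1 p)), τ.orient (σ p) =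
        ∏ p ∈ univ.filter (fun p => cycleKey σ p < cycleKey σ (τ.1 p)), τ.orient p := by
      refine prod_equiv σ (fun p => ?_) fun _ _ => rfl
      rw [hmem, hmem, apply_comm hc, cycleKey_apply, cycleKey_apply]
    rw [this, ← prod_mul_distrib]
    exact prod_eq_one fun p _ => orient_mul_self τ p
  · intro p hp hp'
    rw [hmem] at hp hp'
    rw [apply_apply] at hp'
    exact lt_asymm hp hp'
  · intro p hp
    rw [hmem, hmem, apply_apply]
    exact lt_or_gt_of_ne fun h => hp (apply_eq_self_of_cycleKey_eq hc hτ h.symm)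

/-- A uniform exponent `e` such that `σ ^ e` is a square root of `σ` on all odd cycles. -/
lemma exists_pow_two_mul_apply_eq_apply_of_odd (N : ℕ) : ∃ e : ℕ,
    ∀ (σ : Equiv.Perm (Fin N)) (p : Fin N), Odd (Function.minimalPeriod σ p) →
      (σ ^ (2 * e)) p = σ p := by
  obtain ⟨e, he⟩ : Odd (ordCompl[2] (Nat.card (Equiv.Perm (Fin N)))) :=
    Nat.not_even_iff_odd.1 fun h =>
      Nat.not_dvd_ordCompl Nat.prime_two Nat.card_pos.ne' (even_iff_two_dvd.1 h)
  -- Here 2e + 1 is the odd part of the group order, so every odd period divides it, and 2(e + 1) =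
  -- 1 + (2e + 1).
  refine ⟨e + 1, fun σ p hp => ?_⟩
  have hdvd : Function.minimalPeriod σ p ∣ Nat.card (Equiv.Perm (Fin N)) :=
    pow_apply_eq_self_iff.1 (by rw [pow_card_eq_one', one_apply])
  rw [← Nat.ordProj_mul_ordCompl_eq_self (Nat.card (Equiv.Perm (Fin N))) 2] at hdvd
  have h := ((Nat.coprime_two_right.2 hp).pow_right _).dvd_of_dvd_mul_left hdvd
  rw [he] at h
  rw [show 2 * (e + 1) = 1 + (2 * e + 1) by ring, pow_add, mul_apply,
    pow_apply_eq_self_iff.2 h, pow_one]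

/-- The square root of `σ` attached to an involution `τ`: it maps the lower of two `σ`-cycles
exchanged by `τ` to the upper one by `τ`. -/
noncomputable def sqrtFun (e : ℕ) (σ : Equiv.Perm (Fin N)) (τ : Involutions N) (p : Fin N) :
    Fin N :=
  if cycleKey σ p < cycleKey σ (τ.1 p) then τ.1 p
  else if cycleKey σ (τ.1 p) < cycleKey σ p then σ (τ.1 p)
  else (σ ^ e) p

/-- The involution attached to a square root `ρ` of `σ`: it exchanges the two `σ`-cycles that
make up an even cycle of `ρ`. -/
noncomputable def involFun (σ ρ : Equiv.Perm (Fin N)) (p : Fin N) : Fin N :=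
  if cycleKey σ p < cycleKey σ (ρ p) then ρ p
  else if cycleKey σ (ρ p) < cycleKey σ p then ρ.symm p
  else p

section SqrtFun

variable {e : ℕ} {σ : Equiv.Perm (Fin N)} {τ : Involutions N}

lemma sqrtFun_of_lt {p : Fin N} (h : cycleKey σ p < cycleKey σ (τ.1 p)) :
    sqrtFun e σ τ p = τ.1 p := if_pos h

lemma sqrtFun_of_gt {p : Fin N} (h : cycleKey σ (τ.1 p) < cycleKey σ p) :
    sqrtFun e σ τ p = σ (τ.1 p) := by
  rw [sqrtFun, if_neg h.not_gt, if_pos h]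

lemma sqrtFun_of_eq {p : Fin N} (h : cycleKey σ (τ.1 p) = cycleKey σ p) :
    sqrtFun e σ τ p = (σ ^ e) p := by
  rw [sqrtFun, if_neg h.not_gt, if_neg h.not_lt]

/-- Between exchanged cycles one goes up by τ and down by στ, and both composites are σ because τ
commutes with σ. On the other cycles the choice of e applies. -/
lemma sqrtFun_sqrtFun
    (he : ∀ (σ : Equiv.Perm (Fin N)) (p : Fin N), Odd (Function.minimalPeriod σ p) →
      (σ ^ (2 * e)) p = σ p)
    (hc : Commute σ τ.1) (hτ : evenStable σ τ = ∅) (p : Fin N) :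
    sqrtFun e σ τ (sqrtFun e σ τ p) = σ p := by
  rcases lt_trichotomy (cycleKey σ p) (cycleKey σ (τ.1 p)) with h | h | h
  · rw [sqrtFun_of_lt h, sqrtFun_of_gt (by rwa [apply_apply]), apply_apply]
  · have hp := apply_eq_self_of_cycleKey_eq hc hτ h.symm
    have hodd := notMem_evenStable_iff.1 (by rw [hτ]; exact notMem_empty p) h.symm
    have hpow := apply_zpow_comm hc e p
    rw [zpow_natCast, hp] at hpow
    rw [sqrtFun_of_eq h.symm, sqrtFun_of_eq (by rw [hpow]), ← mul_apply, ← pow_add, ← two_mul,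
      he σ p hodd]
  · have h1 : τ.1 (σ (τ.1 p)) = σ p := by rw [apply_comm hc, apply_apply]
    rw [sqrtFun_of_gt h, sqrtFun_of_lt (by rwa [h1, cycleKey_apply, cycleKey_apply]), h1]

/-- The root permutes the σ-cycles as τ does, so `involFun` applied to it branches the same way. -/
lemma cycleKey_sqrtFun (p : Fin N) :
    cycleKey σ (sqrtFun e σ τ p) = cycleKey σ (τ.1 p) := by
  rcases lt_trichotomy (cycleKey σ p) (cycleKey σ (τ.1 p)) with h | h | h
  · rw [sqrtFun_of_lt h]
  · rw [sqrtFun_of_eq h.symm, cycleKey_pow_apply, h]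
  · rw [sqrtFun_of_gt h, cycleKey_apply]

end SqrtFun

section InvolFun

variable {σ ρ : Equiv.Perm (Fin N)}

lemma involFun_of_lt {p : Fin N} (h : cycleKey σ p < cycleKey σ (ρ p)) :
    involFun σ ρ p = ρ p := if_pos h

lemma involFun_of_gt {p : Fin N} (h : cycleKey σ (ρ p) < cycleKey σ p) :
    involFun σ ρ p = ρ.symm p := by
  rw [involFun, if_neg h.not_gt, if_pos h]

lemma involFun_of_eq {p : Fin N} (h : cycleKey σ (ρ p) = cycleKey σ p) :
    involFun σ ρ p = p := by
  rw [involFun, if_neg h.not_gt, if_neg h.not_lt]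

lemma cycleKey_symm_apply (hρ : ρ * ρ = σ) (p : Fin N) :
    cycleKey σ (ρ.symm p) = cycleKey σ (ρ p) := by
  have : ρ p = σ (ρ.symm p) := by rw [← hρ, mul_apply, Equiv.apply_symm_apply]
  rw [this, cycleKey_apply]

lemma cycleKey_involFun (hρ : ρ * ρ = σ) (p : Fin N) :
    cycleKey σ (involFun σ ρ p) = cycleKey σ (ρ p) := by
  rcases lt_trichotomy (cycleKey σ p) (cycleKey σ (ρ p)) with h | h | h
  · rw [involFun_of_lt h]
  · rw [involFun_of_eq h.symm, h]
  · rw [involFun_of_gt h, cycleKey_symm_apply hρ]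

lemma involFun_involFun (hρ : ρ * ρ = σ) (p : Fin N) : involFun σ ρ (involFun σ ρ p) = p := by
  have hk : cycleKey σ (ρ (ρ p)) = cycleKey σ p := by
    rw [← mul_apply, hρ, cycleKey_apply]
  rcases lt_trichotomy (cycleKey σ p) (cycleKey σ (ρ p)) with h | h | h
  · rw [involFun_of_lt h, involFun_of_gt (by rwa [hk]), Equiv.symm_apply_apply]
  · rw [involFun_of_eq h.symm, involFun_of_eq h.symm]
  · rw [involFun_of_gt h, involFun_of_lt (by rwa [Equiv.apply_symm_apply, cycleKey_symm_apply hρ]),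
      Equiv.apply_symm_apply]

lemma involFun_apply_comm (hρ : ρ * ρ = σ) (p : Fin N) :
    σ (involFun σ ρ p) = involFun σ ρ (σ p) := by
  have h1 : ∀ q, σ (ρ q) = ρ (σ q) := fun q => by rw [← hρ]; rfl
  have h2 : ρ.symm (σ p) = σ (ρ.symm p) := by rw [Equiv.symm_apply_eq, ← h1, Equiv.apply_symm_apply]
  unfold involFun
  rw [← h1, h2, cycleKey_apply, cycleKey_apply]
  split_ifs <;> rfl

/-- If σ^i (ρ p) = p, then ρ^(2i+1) p = p. -/
lemma odd_minimalPeriod_of_cycleKey_eq (hρ : ρ * ρ = σ) {p : Fin N}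
    (h : cycleKey σ (ρ p) = cycleKey σ p) : Odd (Function.minimalPeriod ρ p) := by
  obtain ⟨i, hi⟩ := (cycleKey_eq_iff.1 h).exists_nat_pow_eq
  have : (ρ ^ (2 * i + 1)) p = p := by
    rw [pow_succ, pow_mul, pow_two, hρ, mul_apply, hi]
  exact Odd.of_dvd_nat (odd_two_mul_add_one i) (pow_apply_eq_self_iff.1 this)

end InvolFun

/-- The signed count of the involutions commuting with `σ` is the number of square roots
of `σ`. -/
theorem sum_S_commute_eq_card_sqrt (σ : Equiv.Perm (Fin N))
    [DecidablePred fun τ : Involutions N => Commute σ τ.1] :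
    ∑ τ ∈ univ.filter (fun τ : Involutions N => Commute σ τ.1), S σ τ =
      ((univ.filter fun ρ : Equiv.Perm (Fin N) => ρ * ρ = σ).card : ℂ) := by
  classical
  obtain ⟨e, he⟩ := exists_pow_two_mul_apply_eq_apply_of_odd N
  have hmem : ∀ τ : Involutions N, τ ∈ univ.filter (fun τ : Involutions N =>
      Commute σ τ.1 ∧ ¬ (evenStable σ τ).Nonempty) ↔ Commute σ τ.1 ∧ evenStable σ τ = ∅ :=
    fun τ => by simp [not_nonempty_iff_eq_empty]
  rw [← sum_filter_add_sum_filter_not _ fun τ => (evenStable σ τ).Nonempty, filter_filter,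
    filter_filter, sum_S_evenStable_nonempty, zero_add, sum_congr rfl fun τ hτ =>
      S_eq_one_of_evenStable_eq_empty ((hmem τ).1 hτ).1 ((hmem τ).1 hτ).2,
    sum_const, nsmul_eq_mul, mul_one, Nat.cast_inj]
  have hbij : ∀ τ : Involutions N, Commute σ τ.1 → evenStable σ τ = ∅ →
      Function.Bijective (sqrtFun e σ τ) := fun τ hc hτ =>
    Finite.injective_iff_bijective.1 fun p q hpq => σ.injective <| by
      rw [← sqrtFun_sqrtFun he hc hτ, ← sqrtFun_sqrtFun he hc hτ, hpq]
  refine card_bij'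
    (fun τ hτ => Equiv.ofBijective _ (hbij τ ((hmem τ).1 hτ).1 ((hmem τ).1 hτ).2))
    (fun ρ hρ => ⟨Function.Involutive.toPerm _ (involFun_involFun (mem_filter.1 hρ).2),
      Equiv.ext (involFun_involFun (mem_filter.1 hρ).2)⟩) ?_ ?_ ?_ ?_
  · intro τ hτ
    obtain ⟨hc, hτ⟩ := (hmem τ).1 hτ
    exact mem_filter.2 ⟨mem_univ _, Equiv.ext (sqrtFun_sqrtFun he hc hτ)⟩
  · intro ρ hρ
    have hρ := (mem_filter.1 hρ).2
    refine (hmem _).2 ⟨Equiv.ext (involFun_apply_comm hρ), ?_⟩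
    refine eq_empty_of_forall_notMem fun p => notMem_evenStable_iff.2 fun h => ?_
    have h' : cycleKey σ (ρ p) = cycleKey σ p := (cycleKey_involFun hρ p).symm.trans h
    have hodd := odd_minimalPeriod_of_cycleKey_eq hρ h'
    -- Since σ is a power of ρ, the σ-period of p divides its ρ-period.
    refine Odd.of_dvd_nat hodd (pow_apply_eq_self_iff.1 ?_)
    rw [← hρ, ← pow_two, ← pow_mul]
    exact pow_apply_eq_self_iff.2 (dvd_mul_left _ _)
  · intro τ hτ
    obtain ⟨hc, hτ⟩ := (hmem τ).1 hτ
    refine Subtype.ext (Equiv.ext fun p => ?_)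
    change involFun σ (Equiv.ofBijective _ (hbij τ hc hτ)) p = τ.1 p
    have hk : cycleKey σ (Equiv.ofBijective _ (hbij τ hc hτ) p) = cycleKey σ (τ.1 p) :=
      cycleKey_sqrtFun p
    rcases lt_trichotomy (cycleKey σ p) (cycleKey σ (τ.1 p)) with h | h | h
    · rw [involFun_of_lt (by rwa [hk])]
      exact sqrtFun_of_lt h
    · rw [involFun_of_eq (by rw [hk, h]), apply_eq_self_of_cycleKey_eq hc hτ h.symm]
    · rw [involFun_of_gt (by rwa [hk]), Equiv.symm_apply_eq]
      refine Eq.symm ((sqrtFun_of_lt ?_).trans (apply_apply τ p))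
      rwa [apply_apply]
  · intro ρ hρ
    have hρ := (mem_filter.1 hρ).2
    refine Equiv.ext fun p => ?_
    rw [Equiv.ofBijective_apply]
    have hk := cycleKey_involFun hρ p
    rcases lt_trichotomy (cycleKey σ p) (cycleKey σ (ρ p)) with h | h | h
    · exact (sqrtFun_of_lt (h.trans_eq hk.symm)).trans (involFun_of_lt h)
    · refine (sqrtFun_of_eq (hk.trans h.symm)).trans ?_
      -- The exponent property is applied to ρ rather than σ, which is why e must be uniform over
      -- all permutations.
      rw [← hρ, ← pow_two, ← pow_mul]
      exact he ρ p (odd_minimalPeriod_of_cycleKey_eq hρ h.symm)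
    · refine (sqrtFun_of_gt (hk.trans_lt h)).trans ?_
      change σ (involFun σ ρ p) = ρ p
      rw [involFun_of_gt h, ← hρ, mul_apply, Equiv.apply_symm_apply]

end Involutions

/-! ### The decomposition by length. -/

namespace Involutions

variable {N : ℕ}

lemma conj_eq_self_iff {σ : Equiv.Perm (Fin N)} {τ : Involutions N} :
    conj σ τ = τ ↔ Commute σ τ.1 := by
  rw [Subtype.ext_iff]
  exact mul_inv_eq_iff_eq_mul

lemma exists_hasLength (τ : Involutions N) : ∃ j : Fin (N / 2 + 1), τ.HasLength j := by
  have h2 : τ.1 ^ 2 = 1 := (pow_two _).trans τ.2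
  have hrep : ∀ n ∈ τ.1.cycleType, n = 2 := fun n hn =>
    ((Nat.dvd_prime Nat.prime_two).1
      ((Equiv.Perm.dvd_of_mem_cycleType hn).trans (orderOf_dvd_of_pow_eq_one h2))).resolve_left
      (by have := Equiv.Perm.two_le_of_mem_cycleType hn; omega)
  have hτ := Multiset.eq_replicate_card.2 hrep
  have hsum : τ.1.cycleType.sum ≤ N := by
    rw [Equiv.Perm.sum_cycleType]
    exact (Finset.card_le_univ _).trans_eq (Fintype.card_fin N)
  rw [hτ, Multiset.sum_replicate, smul_eq_mul] at hsum
  exact ⟨⟨Multiset.card τ.1.cycleType, by omega⟩, hτ⟩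

lemma HasLength.eq {τ : Involutions N} {i j : ℕ} (hi : τ.HasLength i) (hj : τ.HasLength j) :
    i = j := by
  have := congrArg Multiset.card (Eq.trans (Eq.symm hi) hj)
  simpa using this

end Involutions

open Involutions

/-- The involutions of each length span subspaces in direct sum. -/
theorem isInternal_lengthSubrep (N : ℕ) :
    DirectSum.IsInternal
      (fun j : Fin (N / 2 + 1) => (lengthSubrep N (j : ℕ)).toSubmodule) := by
  have hli : LinearIndependent ℂ fun τ : Involutions N => Finsupp.single τ (1 : ℂ) :=
    Finsupp.coe_basisSingleOne (R := ℂ) (ι := Involutions N) ▸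
      Finsupp.basisSingleOne.linearIndependent
  rw [DirectSum.isInternal_submodule_iff_iSupIndep_and_iSup_eq_top]
  constructor
  · intro j
    have hle : (⨆ (i) (_ : i ≠ j), (lengthSubrep N (i : ℕ)).toSubmodule) ≤
        Submodule.span ℂ ((fun τ : Involutions N => Finsupp.single τ (1 : ℂ)) ''
          {τ | ¬ τ.HasLength j}) :=
      iSup₂_le fun i hij => Submodule.span_mono <| Set.image_mono fun τ hτ hτ' =>
        hij (Fin.ext (HasLength.eq hτ hτ'))
    refine Disjoint.mono_right hle (hli.disjoint_span_image ?_)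
    exact Set.disjoint_left.2 fun τ h h' => h' h
  · refine eq_top_iff.2 fun v _ => ?_
    induction v using Finsupp.induction_linear with
    | zero => exact Submodule.zero_mem _
    | add v w hv hw => exact Submodule.add_mem _ (hv trivial) (hw trivial)
    | single τ c =>
      obtain ⟨j, hj⟩ := τ.exists_hasLength
      refine Submodule.mem_iSup_of_mem j ?_
      rw [← mul_one c, ← smul_eq_mul, ← Finsupp.smul_single]
      exact Submodule.smul_mem _ _ (Submodule.subset_span ⟨τ, hj, rfl⟩)

/-! ### The character of A and its scalar products with irreducible characters. -/

/-- The character of the signed conjugation representation counts square roots. -/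
theorem character_signedConjRep (N : ℕ) (σ : Equiv.Perm (Fin N)) :
    (signedConjRep N).character σ =
      ((Finset.univ.filter fun ρ : Equiv.Perm (Fin N) => ρ * ρ = σ).card : ℂ) := by
  classical
  have hsingle : ∀ τ : Involutions N, signedConjRep N σ (Finsupp.single τ (1 : ℂ)) =
      S σ τ • Finsupp.single (conj σ τ) (1 : ℂ) := fun τ => by simp [signedConjRep]
  rw [← sum_S_commute_eq_card_sqrt, Finset.sum_filter, Representation.character,
    LinearMap.trace_eq_matrix_trace ℂ (Finsupp.basisSingleOne (R := ℂ) (ι := Involutions N))]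
  refine Finset.sum_congr rfl fun τ _ => ?_
  simp only [Matrix.diag, LinearMap.toMatrix_apply, Finsupp.coe_basisSingleOne, hsingle,
    ← conj_eq_self_iff]
  simp [Finsupp.single_apply]

/-- A permutation and its inverse have the same cycle type, hence are conjugate. -/
theorem Equiv.Perm.character_inv {α V : Type*} [Fintype α] [DecidableEq α] [AddCommGroup V]
    [Module ℂ V] (θ : Representation ℂ (Equiv.Perm α) V) (σ : Equiv.Perm α) :
    θ.character σ⁻¹ = θ.character σ := by
  obtain ⟨g, hg⟩ := isConj_iff.1
    (Equiv.Perm.isConj_iff_cycleType_eq.2 (Equiv.Perm.cycleType_inv σ).symm)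
  rw [← hg, Representation.char_conj]

/-- Every irreducible character of the symmetric group has scalar product `1` with the character
of the signed conjugation representation. -/
theorem inner_character_signedConjRep (N : ℕ) {W : Type*} [AddCommGroup W] [Module ℂ W]
    [FiniteDimensional ℂ W] (θ : Representation ℂ (Equiv.Perm (Fin N)) W) (hθ : θ.IsIrreducible) :
    (Nat.card (Equiv.Perm (Fin N)) : ℂ)⁻¹ *
      ∑ g, (signedConjRep N).character g * θ.character g⁻¹ = 1 := by
  have : Invertible (Nat.card (Equiv.Perm (Fin N)) : ℂ) := invertibleOfNonzero (by simp)
  have hnat := Representation.card_inv_mul_sum_char_mul_char_eq_finrank θ (signedConjRep N)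
  -- Counting square roots turns the sum over g into a sum over ρ, grouped by the value of ρ².
  have hsum : ∑ g, (signedConjRep N).character g * θ.character g⁻¹ =
      ∑ ρ : Equiv.Perm (Fin N), θ.character (ρ * ρ) := by
    refine Eq.trans (Finset.sum_congr rfl fun σ _ => ?_)
      (Finset.sum_fiberwise Finset.univ (fun ρ : Equiv.Perm (Fin N) => ρ * ρ) _)
    rw [character_signedConjRep, Equiv.Perm.character_inv, ← nsmul_eq_mul, ← Finset.sum_const]
    exact Finset.sum_congr rfl fun ρ hρ => by rw [(Finset.mem_filter.1 hρ).2]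
  rcases Representation.frobeniusSchur_eq_one_or_neg_one θ (Equiv.Perm.character_inv θ) with h | h
  · rw [hsum, h]
  -- Indicator −1 is impossible: the scalar product is the dimension of a space of intertwining
  -- maps.
  · rw [hsum, h] at hnat
    have : ((Module.finrank ℂ (θ.IntertwiningMap (signedConjRep N)) + 1 : ℕ) : ℂ) = 0 := by
      rw [Nat.cast_add, ← hnat, Nat.cast_one, neg_add_cancel]
    exact absurd (Nat.cast_eq_zero.1 this) (Nat.succ_ne_zero _)

theorem theorem1 (N : ℕ) (hN : 0 < N) :
    DirectSum.IsInternal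
      (fun j : Fin (N / 2 + 1) => (lengthSubrep N (j : ℕ)).toSubmodule) ∧
    IsGelfandModel.{0, 0, w} (signedConjRep N) :=
  ⟨isInternal_lengthSubrep N,
    Representation.isGelfandModel_of_inner_character_eq_one _ fun _ _ _ _ θ hθ =>
      inner_character_signedConjRep N θ hθ⟩
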